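/- Let $\mathcal{C}$ be an abelian category and $\mathcal{Q}$ a poset (viewed as a category). A functor $X\colon\mathcal{Q}\to\mathcal{C}$ is \emph{discretized} by a poset map $\alpha\colon\mathcal{D}\to\mathcal{Q}$ with $\mathcal{D}$ finite if $X$ is isomorphic to the left Kan extension along $\alpha$ of some functor $Y\colon\mathcal{D}\to\mathcal{C}$; $X$ is \emph{tame} if it is discretized by some such $\alpha$. Let $\mathrm{Tame}(\mathcal{Q},\mathcal{C})$ be the full subcategory of tame functors in $\mathrm{Fun}(\mathcal{Q},\mathcal{C})$. For a poset $\mathcal{D}$ let $\mathcal{D}_\ast=\mathcal{D}\cup\{-\infty\}$ be $\mathcal{D}$ with a new global minimum added. A poset map $\alpha\colon\mathcal{D}\to\mathcal{Q}$ \emph{admits a transfer} if the map $\alpha_\ast\colon\mathcal{D}_\ast\to\mathcal{Q}_\ast$ that extends $\alpha$ by $-\infty\mapsto-\infty$ has a right adjoint. The poset $\mathcal{Q}$ is of \emph{dimension at most $1$} if $w\le u\le x$ and $w\le v\le x$ in $\mathcal{Q}$ imply that $u$ and $v$ are comparable. An abelian category satisfies the \emph{minimal cover axiom} if for every object $X$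 there is an epimorphism $p\colon P\to X$ with $P$ projective such that every $\varphi\colon P\to P$ with $p\varphi=p$ is an isomorphism. The projective dimension in $\{0,1,2,\dots,\infty\}$ of an object is the smallest length of a projective resolution of it, where the length of $P_\bullet$ is the smallest $n\ge 0$ with $P_k=0$ for all $k>n$, or $\infty$ if there is no such $n$; the projective dimension $\text{proj-dim}$ of an abelian category with enough projectives is the supremum of the projective dimensions of its objects. Assume that every functor in $\mathrm{Tame}(\mathcal{Q},\mathcal{C})$ is discretized by a poset map (from a finite poset) that admits a transfer. Then: \begin{enumerate} \item The category $\mathrm{Tame}(\mathcal{Q},\mathcal{C})$ is abelian. \item If $\mathcal{C}$ has enough projectives, then so does $\mathrm{Tame}(\mathcal{Q},\mathcal{C})$. \item If $\mathcal{C}$ satisfies the minimal cover axiom, then so does $\mathrm{Tame}(\mathcal{Q},\mathcal{C})$. \item If $\mathcal{C}$ has enough projectives and $\mathcal{Q}$ is of dimension at most $1$, then \[\text{proj-dim}(\mathrm{Tame}(\mathcal{Q},\mathcal{C}))\le\text{proj-dim}(\mathcal{C})+1.\] \end{enumerate} -/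

import Mathlib

open CategoryTheory CategoryTheory.Limits

universe u v w

namespace TameFunctors

section Posets

/-- The poset map `α : D → Q` admits a transfer: the induced map `α_* : D ∪ {-∞} → Q ∪ {-∞}`
has a right adjoint (for posets, an adjunction is a Galois connection). -/
def AdmitsTransfer {D Q : Type*} [PartialOrder D] [PartialOrder Q] (α : D →o Q) : Prop :=
  ∃ r : WithBot Q →o WithBot D, GaloisConnection (WithBot.map α) r

/-- A poset has dimension at most `1` if any two elements of an interval `[a, b]` are
comparable. -/
def DimLEOne (Q : Type*) [PartialOrder Q] : Prop :=
  ∀ a x y b : Q, a ≤ x → x ≤ b → a ≤ y → y ≤ b → x ≤ y ∨ y ≤ x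

end Posets

section Tame

variable {Q : Type u} [PartialOrder Q] {C : Type w} [Category.{v} C]

/-- `X : Q ⥤ C` is discretized by the poset map `α : D → Q` if `X` is (together with a suitable
natural transformation) a left Kan extension along `α` of some functor `Y : D ⥤ C`. -/
def IsDiscretizedBy {D : Type*} [PartialOrder D] (X : Q ⥤ C) (α : D →o Q) : Prop :=
  ∃ (Y : D ⥤ C) (η : Y ⟶ α.monotone.functor ⋙ X), X.IsLeftKanExtension η

variable (Q C) in
/-- A functor `Q ⥤ C` is tame if it is discretized by a poset map from a finite poset. (Every
finite poset is isomorphic to one in the universe of `Q`.) -/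
def isTame : ObjectProperty (Q ⥤ C) := fun X =>
  ∃ (D : Type u) (_ : PartialOrder D) (α : D →o Q), Finite D ∧ IsDiscretizedBy X α

variable (Q C) in
/-- The category of tame functors, as a full subcategory of `Q ⥤ C`. -/
abbrev Tame : Type (max u v w) := (isTame Q C).FullSubcategory

variable (Q C) in
/-- Every tame functor `Q ⥤ C` is discretized by a poset map, from a finite poset, that admits a
transfer. -/
def TameDiscretizableByTransfers : Prop :=
  ∀ X : Q ⥤ C, isTame Q C X →
    ∃ (D : Type u) (_ : PartialOrder D) (α : D →o Q),
      Finite D ∧ AdmitsTransfer α ∧ IsDiscretizedBy X α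

end Tame

section Minimality

variable {C : Type w} [Category.{v} C]

/-- A morphism `f : X ⟶ Y` is minimal if every endomorphism of `X` over `Y` is an isomorphism. -/
def IsMinimalMorphism {X Y : C} (f : X ⟶ Y) : Prop :=
  ∀ φ : X ⟶ X, φ ≫ f = f → IsIso φ

variable (C) in
/-- The minimal cover axiom: every object is the target of a minimal epimorphism from a
projective object. -/
def MinimalCoverAxiom : Prop :=
  ∀ X : C, ∃ (P : C) (p : P ⟶ X), Projective P ∧ Epi p ∧ IsMinimalMorphism p

end Minimality

section ProjectiveDimension

variable {C : Type w} [Category.{v} C] [Abelian C]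

/-- The length of a projective resolution `P`: the smallest natural number `n` with `P_k = 0` for
all `k > n`, and `⊤` if there is none. -/
noncomputable def resolutionLength {X : C} (P : ProjectiveResolution X) : ℕ∞ :=
  sInf {n : ℕ∞ | ∀ k : ℕ, n < k → IsZero (P.complex.X k)}

/-- The projective dimension of an object: the smallest length of a projective resolution. -/
noncomputable def projDim (X : C) : ℕ∞ :=
  ⨅ P : ProjectiveResolution X, resolutionLength P

variable (C) in
/-- The projective dimension of an abelian category (with enough projectives): the supremum of the
projective dimensions of its objects. -/
noncomputable def catProjDim : ℕ∞ :=
  ⨆ X : C, projDim X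

end ProjectiveDimension

end TameFunctors

/-! Constructibility over a finite set `S` with floors replaces tameness by a pointwise condition. A
transfer sends `q` to the largest `d` with `α d ≤ q`, or to `⊥`; so a left Kan extension along `α`
is zero at `q` or agrees there with its value at the floor of `q` in the range of `α`
(`AdmitsTransfer.isConstructible`). Conversely, a functor constructible over `S` is the Kan
extension of its own restriction to `S` (`IsConstructible.isDiscretizedBy`). For fixed `S`,
constructibility passes to limits, colimits and retracts, and two tame functors share an `S` because
the hypothesis applies to their biproduct (`exists_isConstructible_pair`). Hence tame functors are
closed under kernels, cokernels and finite products in `Q ⥤ C`.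

Free functors on projectives are projective, and covering the values at the elements of `S` covers
the whole functor. For minimal covers one covers the top parts instead, that is, `X s` modulo the
images from below in `S`; a Nakayama lemma (`IsConstructible.epi_of_epi_topPart`) lifts information
from top parts to functors.

In dimension at most one, the elements of `S` between `s` and `q` form a chain. So `X` is the
cokernel of a monomorphism of free functors, from one generator per covering pair of `S` to one per
element of `S` (`edgeVertex_shortExact`). Forming free functors is exact and preserves projectives,
so both have projective dimension at most that of `C`, and `X` at most one more. -/

namespace TameFunctors

/-! ### Isomorphisms and zero objects under limits and colimits. -/

section Limits

variable {A B J : Type*} [Category* A] [Category* B] [Category* J]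

/-- Both images of the cone are limit cones, and the induced comparison of cone points is `τ.app
c.pt`. Applied below to evaluation functors at `s ≤ q`. -/
lemma isIso_app_of_isLimit {F G : A ⥤ B} (τ : F ⟶ G) {K : J ⥤ A} {c : Cone K} (hc : IsLimit c)
    [PreservesLimit K F] [PreservesLimit K G] (h : ∀ j, IsIso (τ.app (K.obj j))) :
    IsIso (τ.app c.pt) := by
  have : ∀ j, IsIso ((Functor.whiskerLeft K τ).app j) := h
  have : IsIso (Functor.whiskerLeft K τ) := NatIso.isIso_of_isIso_app _
  let e := IsLimit.conePointsIsoOfNatIso (isLimitOfPreserves F hc) (isLimitOfPreserves G hc)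
    (asIso (Functor.whiskerLeft K τ))
  have he : e.hom = τ.app c.pt := (isLimitOfPreserves G hc).hom_ext fun j =>
    (IsLimit.conePointsIsoOfNatIso_hom_comp _ _ _ _).trans (τ.naturality (c.π.app j))
  rw [← he]
  infer_instance

lemma isIso_app_of_isColimit {F G : A ⥤ B} (τ : F ⟶ G) {K : J ⥤ A} {c : Cocone K}
    (hc : IsColimit c) [PreservesColimit K F] [PreservesColimit K G]
    (h : ∀ j, IsIso (τ.app (K.obj j))) : IsIso (τ.app c.pt) := by
  have : ∀ j, IsIso ((Functor.whiskerLeft K τ).app j) := h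
  have : IsIso (Functor.whiskerLeft K τ) := NatIso.isIso_of_isIso_app _
  let e := IsColimit.coconePointsIsoOfNatIso (isColimitOfPreserves F hc)
    (isColimitOfPreserves G hc) (asIso (Functor.whiskerLeft K τ))
  have he : e.hom = τ.app c.pt := (isColimitOfPreserves F hc).hom_ext fun j =>
    (IsColimit.comp_coconePointsIsoOfNatIso_hom _ _ _ _).trans (τ.naturality (c.ι.app j)).symm
  rw [← he]
  infer_instance

variable [HasZeroMorphisms B]

lemma isZero_of_isLimit {K : J ⥤ B} {c : Cone K} (hc : IsLimit c)
    (h : ∀ j, IsZero (K.obj j)) : IsZero c.pt :=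
  (IsZero.iff_id_eq_zero _).2 (hc.hom_ext fun j => (h j).eq_of_tgt _ _)

lemma isZero_of_isColimit {K : J ⥤ B} {c : Cocone K} (hc : IsColimit c)
    (h : ∀ j, IsZero (K.obj j)) : IsZero c.pt :=
  (IsZero.iff_id_eq_zero _).2 (hc.hom_ext fun j => (h j).eq_of_src _ _)

end Limits

/-! ### Constructible functors and their stability. -/

section Constructible

variable {Q : Type u} [PartialOrder Q] {C : Type w} [Category.{v} C]

/-- Every element of `Q` above some element of `S` is above a greatest one. -/
def HasFloors (S : Set Q) : Prop :=
  ∀ q s, s ∈ S → s ≤ q → ∃ t, IsGreatest (S ∩ Set.Iic q) t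

/-- A functor is constructible with respect to `S` if it vanishes on elements not above any
element of `S`, and its value at any other `q` is its value at the greatest element of `S`
below `q`. -/
structure IsConstructible (S : Set Q) (X : Q ⥤ C) : Prop where
  isZero : ∀ q, (∀ s ∈ S, ¬ s ≤ q) → IsZero (X.obj q)
  isIso : ∀ s q (h : s ≤ q), IsGreatest (S ∩ Set.Iic q) s → IsIso (X.map (homOfLE h))

lemma IsConstructible.of_retract [HasZeroMorphisms C] {S : Set Q} {X Y : Q ⥤ C} (r : Retract X Y)
    (hY : IsConstructible S Y) : IsConstructible S X where
  isZero q hq := by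
    rw [IsZero.iff_id_eq_zero]
    have h : r.i.app q ≫ r.r.app q = 𝟙 _ := by rw [← NatTrans.comp_app, r.retract]; rfl
    rw [← h, (hY.isZero q hq).eq_of_tgt (r.i.app q) 0, zero_comp]
  isIso s q h hs := by
    have h1 : r.i.app q ≫ r.r.app q = 𝟙 _ := by rw [← NatTrans.comp_app, r.retract]; rfl
    have h2 : r.i.app s ≫ r.r.app s = 𝟙 _ := by rw [← NatTrans.comp_app, r.retract]; rfl
    have := hY.isIso s q h hs
    refine ⟨r.i.app q ≫ inv (Y.map (homOfLE h)) ≫ r.r.app s, ?_, ?_⟩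
    · rw [NatTrans.naturality_assoc, IsIso.hom_inv_id_assoc, h2]
    · rw [Category.assoc, Category.assoc, ← NatTrans.naturality, IsIso.inv_hom_id_assoc, h1]

variable {J : Type*} [Category* J]

lemma IsConstructible.of_isLimit [HasZeroMorphisms C] [HasLimitsOfShape J C] {S : Set Q}
    {K : J ⥤ Q ⥤ C} {c : Cone K} (hc : IsLimit c) (h : ∀ j, IsConstructible S (K.obj j)) :
    IsConstructible S c.pt where
  isZero q hq := isZero_of_isLimit (isLimitOfPreserves ((evaluation Q C).obj q) hc)
    fun j => (h j).isZero q hq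
  isIso s q hsq hs := isIso_app_of_isLimit ((evaluation Q C).map (homOfLE hsq)) hc
    fun j => (h j).isIso s q hsq hs

lemma IsConstructible.of_isColimit [HasZeroMorphisms C] [HasColimitsOfShape J C] {S : Set Q}
    {K : J ⥤ Q ⥤ C} {c : Cocone K} (hc : IsColimit c) (h : ∀ j, IsConstructible S (K.obj j)) :
    IsConstructible S c.pt where
  isZero q hq := isZero_of_isColimit (isColimitOfPreserves ((evaluation Q C).obj q) hc)
    fun j => (h j).isZero q hq
  isIso s q hsq hs := isIso_app_of_isColimit ((evaluation Q C).map (homOfLE hsq)) hc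
    fun j => (h j).isIso s q hsq hs

end Constructible

/-! ### Transfers make Kan extensions constructible. -/

section Kan

open ZeroObject

variable {Q : Type u} [PartialOrder Q] {C : Type w} [Category.{v} C]

lemma isLeftKanExtension_of_existsUnique {D : Type*} [Category* D] {L : D ⥤ Q} {Y : D ⥤ C}
    {X : Q ⥤ C} (η : Y ⟶ L ⋙ X)
    (h₁ : ∀ (M : Q ⥤ C) (β : Y ⟶ L ⋙ M), ∃ γ : X ⟶ M, ∀ d, η.app d ≫ γ.app (L.obj d) = β.app d)
    (h₂ : ∀ (M : Q ⥤ C) (γ γ' : X ⟶ M),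
      (∀ d, η.app d ≫ γ.app (L.obj d) = η.app d ≫ γ'.app (L.obj d)) → γ = γ') :
    X.IsLeftKanExtension η := by
  choose γ hγ using h₁
  refine ⟨⟨IsInitial.ofUniqueHom
    (fun G => StructuredArrow.homMk (γ G.right G.hom) ?_) ?_⟩⟩
  · ext d
    exact hγ _ _ d
  · intro G m
    ext1
    refine h₂ _ _ _ fun d => ?_
    have := congr_app (StructuredArrow.w m) d
    exact this.trans (hγ _ _ d).symm

lemma map_le_iff_of_galoisConnection {D : Type*} [PartialOrder D] {α : D →o Q}
    {r : WithBot Q → WithBot D} (hr : GaloisConnection (WithBot.map α) r) {q : Q} {d : D}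
    (hd : r q = d) (e : D) : α e ≤ q ↔ e ≤ d := by
  rw [← WithBot.coe_le_coe (a := e), ← hd, ← hr]
  simp

lemma AdmitsTransfer.hasFloors {D : Type*} [PartialOrder D] {α : D →o Q} (hα : AdmitsTransfer α) :
    HasFloors (Set.range α) := by
  obtain ⟨r, hr⟩ := hα
  rintro q _ ⟨e, rfl⟩ he
  have : (e : WithBot D) ≤ r q := (hr _ _).1 (by simpa using he)
  obtain ⟨d, hd, -⟩ := WithBot.coe_le_iff.1 this
  have H := map_le_iff_of_galoisConnection hr hd
  refine ⟨α d, ⟨⟨d, rfl⟩, (H d).2 le_rfl⟩, ?_⟩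
  rintro _ ⟨⟨e', rfl⟩, he'⟩
  exact α.monotone ((H e').1 he')

/-- The comma category over `q` is empty or has the terminal object `r q`. So the pointwise Kan
extension exists without cocompleteness of `C`, and its value is zero or `Y` at `r q`. -/
lemma AdmitsTransfer.isConstructible [HasZeroMorphisms C] [HasZeroObject C]
    {D : Type*} [PartialOrder D] {α : D →o Q}
    (hα : AdmitsTransfer α) {X : Q ⥤ C} (hX : IsDiscretizedBy X α) :
    IsConstructible (Set.range α) X := by
  obtain ⟨r, hr⟩ := hα
  obtain ⟨Y, η, hη⟩ := hX
  let L : D ⥤ Q := α.monotone.functor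
  have hr' : ∀ q : Q, (∃ d : D, r (q : WithBot Q) = d) ∨ ∀ e, ¬ α e ≤ q := by
    intro q
    by_cases h : ∃ d : D, r (q : WithBot Q) = d
    · exact Or.inl h
    · refine Or.inr fun e he => h ?_
      have : (e : WithBot D) ≤ r q := (hr _ _).1 (by simpa using he)
      obtain ⟨d, hd, -⟩ := WithBot.coe_le_iff.1 this
      exact ⟨d, hd⟩
  have term : ∀ (q : Q) (d : D) (hd : ∀ e, α e ≤ q ↔ e ≤ d),
      Nonempty (IsTerminal (CostructuredArrow.mk (Y := d) (S := L) (T := q)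
        (homOfLE ((hd d).2 le_rfl)))) := fun q d hd =>
    ⟨IsTerminal.ofUniqueHom
      (fun E => CostructuredArrow.homMk (homOfLE ((hd E.left).1 (leOfHom E.hom)))
        (Subsingleton.elim _ _)) (fun E m => by ext; exact Subsingleton.elim _ _)⟩
  have emp : ∀ q, (∀ e, ¬ α e ≤ q) → IsEmpty (CostructuredArrow L q) := fun q h =>
    ⟨fun E => h E.left (leOfHom E.hom)⟩
  have : Functor.HasPointwiseLeftKanExtension L Y := by
    intro q
    obtain ⟨d, hd⟩ | h := hr' q
    · obtain ⟨ht⟩ := term q d (map_le_iff_of_galoisConnection hr hd)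
      exact ⟨⟨⟨_, colimitOfDiagramTerminal ht _⟩⟩⟩
    · have := emp q h
      exact ⟨⟨⟨⟨(0 : C), { app := fun E => isEmptyElim E, naturality := fun E => isEmptyElim E }⟩,
        { desc := fun _ => 0
          fac := fun _ E => isEmptyElim E
          uniq := fun _ _ _ => (isZero_zero C).eq_of_src _ _ }⟩⟩⟩
  have hp := Functor.isPointwiseLeftKanExtensionOfIsLeftKanExtension X η
  have key : ∀ (q : Q) (d : D) (hd : ∀ e, α e ≤ q ↔ e ≤ d),
      IsIso (η.app d ≫ X.map (homOfLE ((hd d).2 le_rfl))) := by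
    intro q d hd
    obtain ⟨ht⟩ := term q d hd
    exact IsColimit.isIso_ι_app_of_isTerminal (hp q) _ ht
  refine ⟨fun q hq => ?_, fun s q hsq hs => ?_⟩
  · have := emp q fun e => hq _ ⟨e, rfl⟩
    exact (IsZero.iff_id_eq_zero _).2 ((hp q).hom_ext fun E => isEmptyElim E)
  · obtain ⟨d, hd⟩ | h := hr' q
    · have H := map_le_iff_of_galoisConnection hr hd
      obtain rfl : s = α d := by
        obtain ⟨⟨e, rfl⟩, -⟩ := hs.1
        exact le_antisymm (α.monotone ((H e).1 hsq)) (hs.2 ⟨⟨d, rfl⟩, (H d).2 le_rfl⟩)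
      -- The same `d` is terminal over both `q` and `α d`; comparing the two isomorphisms shows that
      -- the structure map from `α d` to `q` is invertible.
      have i1 := key q d H
      have i2 := key (α d) d fun e =>
        ⟨fun he => (H e).1 (he.trans hsq), fun he => α.monotone he⟩
      have e2 : X.map (homOfLE (le_refl (α d))) = 𝟙 _ := X.map_id _
      have : IsIso (η.app d) := by
        have h3 : η.app d ≫ X.map (homOfLE (le_refl (α d))) = η.app d := by
          erw [e2, Category.comp_id]
        rw [← h3]; exact i2
      exact @IsIso.of_isIso_comp_left _ _ _ _ _ (η.app d) (X.map (homOfLE hsq)) this i1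
    · obtain ⟨⟨e, rfl⟩, -⟩ := hs.1
      exact absurd hsq (h e)

end Kan

/-! ### Constructible functors are tame; biproducts of discretized functors. -/

section Kan

variable {Q : Type u} [PartialOrder Q] {C : Type w} [Category.{v} C]

/-- A transformation out of `X` is forced at `q` by its component at the floor of `q`, since the
structure map from the floor is invertible, and by zero where no floor exists. -/
lemma IsConstructible.isDiscretizedBy [HasZeroMorphisms C] {S : Set Q} (hS : HasFloors S)
    {X : Q ⥤ C} (hX : IsConstructible S X) :
    IsDiscretizedBy X (OrderHom.Subtype.val (· ∈ S)) := by
  have floor : ∀ q s, s ∈ S → s ≤ q → ∃ t ∈ S, ∃ h : t ≤ q, (∀ t' ∈ S, t' ≤ q → t' ≤ t) ∧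
      IsIso (X.map (homOfLE h)) := by
    intro q s hs hsq
    obtain ⟨t, ht⟩ := hS q s hs hsq
    exact ⟨t, ht.1.1, ht.1.2, fun t' h h' => ht.2 ⟨h, h'⟩, hX.isIso t q ht.1.2 ht⟩
  refine ⟨(Subtype.mono_coe (· ∈ S)).functor ⋙ X, 𝟙 _, ?_⟩
  refine isLeftKanExtension_of_existsUnique _ (fun M β => ?_) (fun M γ γ' h => ?_)
  · obtain ⟨b, hb⟩ : ∃ b : ∀ s : S, X.obj s ⟶ M.obj s, ∀ s, b s = β.app s :=
      ⟨β.app, fun _ => rfl⟩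
    have hβ : ∀ (s t : S) (h : (s : Q) ≤ t),
        X.map (homOfLE h) ≫ b t = b s ≫ M.map (homOfLE h) := fun s t h => by
      rw [hb, hb]
      exact β.naturality (homOfLE (show s ≤ t from h))
    have : ∀ q, ∃ g : X.obj q ⟶ M.obj q, ∀ (s : S) (h : (s : Q) ≤ q),
        X.map (homOfLE h) ≫ g = b s ≫ M.map (homOfLE h) := by
      intro q
      by_cases hq : ∃ s ∈ S, s ≤ q
      · obtain ⟨s, hs, hsq⟩ := hq
        obtain ⟨t, htS, htq, hmax, hiso⟩ := floor q s hs hsq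
        refine ⟨inv (X.map (homOfLE htq)) ≫ b ⟨t, htS⟩ ≫ M.map (homOfLE htq), ?_⟩
        intro s' hs'
        have hst : (s' : Q) ≤ t := hmax s' s'.2 hs'
        have e : X.map (homOfLE hs') = X.map (homOfLE hst) ≫ X.map (homOfLE htq) := by
          rw [← X.map_comp]; rfl
        have e' : M.map (homOfLE hs') = M.map (homOfLE hst) ≫ M.map (homOfLE htq) := by
          rw [← M.map_comp]; rfl
        rw [e, e', Category.assoc, IsIso.hom_inv_id_assoc]
        exact (reassoc_of% hβ s' ⟨t, htS⟩ hst) (M.map (homOfLE htq))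
      · push Not at hq
        exact ⟨0, fun s h => absurd h (hq s s.2)⟩
    choose g hg using this
    refine ⟨{ app := g, naturality := fun q q' f => ?_ }, fun d => ?_⟩
    · by_cases hq : ∃ s ∈ S, s ≤ q
      · obtain ⟨s, hs, hsq⟩ := hq
        obtain ⟨t, htS, htq, -, hiso⟩ := floor q s hs hsq
        have e : X.map (homOfLE htq) ≫ X.map f = X.map (homOfLE (htq.trans f.le)) := by
          rw [← X.map_comp]; rfl
        have e' : M.map (homOfLE htq) ≫ M.map f = M.map (homOfLE (htq.trans f.le)) := by
          rw [← M.map_comp]; rfl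
        rw [← cancel_epi (X.map (homOfLE htq)), reassoc_of% e, hg q' ⟨t, htS⟩ _,
          reassoc_of% hg q ⟨t, htS⟩ htq, ← e']
      · push Not at hq
        exact (hX.isZero q hq).eq_of_src _ _
    · have := hg d d le_rfl
      erw [X.map_id, M.map_id, Category.id_comp, Category.comp_id] at this
      exact (Category.id_comp _).trans (this.trans (hb d))
  · ext q
    by_cases hq : ∃ s ∈ S, s ≤ q
    · obtain ⟨s, hs, hsq⟩ := hq
      obtain ⟨t, htS, htq, -, hiso⟩ := floor q s hs hsq
      rw [← cancel_epi (X.map (homOfLE htq)), γ.naturality, γ'.naturality]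
      congr 1
      have := h ⟨t, htS⟩
      erw [Category.id_comp, Category.id_comp] at this
      exact this
    · push Not at hq
      exact (hX.isZero q hq).eq_of_src _ _

lemma IsConstructible.isTame [HasZeroMorphisms C] {S : Set Q} (hfin : S.Finite)
    (hS : HasFloors S) {X : Q ⥤ C} (hX : IsConstructible S X) : isTame Q C X :=
  ⟨S, inferInstance, OrderHom.Subtype.val (· ∈ S), hfin.to_subtype, hX.isDiscretizedBy hS⟩

section Sum

variable {D₁ D₂ : Type*}

variable (D₁ D₂) in
/-- The disjoint union of two posets. -/
inductive DisjointUnion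
  | inl : D₁ → DisjointUnion
  | inr : D₂ → DisjointUnion

namespace DisjointUnion

/-- The bijection of the disjoint union with the sum type. -/
def toSum : DisjointUnion D₁ D₂ → D₁ ⊕ D₂
  | inl a => .inl a
  | inr b => .inr b

lemma toSum_injective : Function.Injective (toSum : DisjointUnion D₁ D₂ → D₁ ⊕ D₂) := by
  rintro (_ | _) (_ | _) h <;> simp_all [toSum]

variable [PartialOrder D₁] [PartialOrder D₂]

instance : PartialOrder (DisjointUnion D₁ D₂) := PartialOrder.lift toSum toSum_injective

instance [Finite D₁] [Finite D₂] : Finite (DisjointUnion D₁ D₂) :=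
  Finite.of_injective toSum toSum_injective

lemma inl_le_inl_iff {a b : D₁} : (inl a : DisjointUnion D₁ D₂) ≤ inl b ↔ a ≤ b :=
  Sum.inl_le_inl_iff

lemma inr_le_inr_iff {a b : D₂} : (inr a : DisjointUnion D₁ D₂) ≤ inr b ↔ a ≤ b :=
  Sum.inr_le_inr_iff

lemma not_inl_le_inr {a : D₁} {b : D₂} : ¬ (inl a : DisjointUnion D₁ D₂) ≤ inr b :=
  Sum.not_inl_le_inr

lemma not_inr_le_inl {a : D₁} {b : D₂} : ¬ (inr b : DisjointUnion D₁ D₂) ≤ inl a :=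
  Sum.not_inr_le_inl

end DisjointUnion

variable [PartialOrder D₁] [PartialOrder D₂]

/-- The functor on a disjoint union of posets given by functors on the summands. -/
def sumFunctor (Y₁ : D₁ ⥤ C) (Y₂ : D₂ ⥤ C) :
    DisjointUnion D₁ D₂ ⥤ C where
  obj
    | .inl d => Y₁.obj d
    | .inr d => Y₂.obj d
  map {a b} f := match a, b, f with
    | .inl _, .inl _, f => Y₁.map (homOfLE (DisjointUnion.inl_le_inl_iff.1 f.le))
    | .inr _, .inr _, f => Y₂.map (homOfLE (DisjointUnion.inr_le_inr_iff.1 f.le))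
    | .inl _, .inr _, f => (DisjointUnion.not_inl_le_inr f.le).elim
    | .inr _, .inl _, f => (DisjointUnion.not_inr_le_inl f.le).elim
  map_id a := match a with
    | .inl _ => Y₁.map_id _
    | .inr _ => Y₂.map_id _
  map_comp {a b c} f g := match a, b, c, f, g with
    | .inl _, .inl _, .inl _, _, _ => Y₁.map_comp _ _
    | .inr _, .inr _, .inr _, _, _ => Y₂.map_comp _ _
    | .inl _, .inr _, _, f, _ => (DisjointUnion.not_inl_le_inr f.le).elim
    | .inr _, .inl _, _, f, _ => (DisjointUnion.not_inr_le_inl f.le).elim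
    | .inl _, .inl _, .inr _, _, g => (DisjointUnion.not_inl_le_inr g.le).elim
    | .inr _, .inr _, .inl _, _, g => (DisjointUnion.not_inr_le_inl g.le).elim

/-- The poset map on a disjoint union of posets given by poset maps on the summands. -/
def sumOrderHom (α₁ : D₁ →o Q) (α₂ : D₂ →o Q) : DisjointUnion D₁ D₂ →o Q where
  toFun
    | .inl d => α₁ d
    | .inr d => α₂ d
  monotone' a b h := match a, b, h with
    | .inl _, .inl _, h => α₁.monotone (DisjointUnion.inl_le_inl_iff.1 h)
    | .inr _, .inr _, h => α₂.monotone (DisjointUnion.inr_le_inr_iff.1 h)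
    | .inl _, .inr _, h => (DisjointUnion.not_inl_le_inr h).elim
    | .inr _, .inl _, h => (DisjointUnion.not_inr_le_inl h).elim

/-- Maps out of the biproduct, like maps out of a functor on the disjoint union, are pairs of maps,
so the two universal properties combine. -/
lemma IsDiscretizedBy.biprod [HasZeroMorphisms C] {α₁ : D₁ →o Q} {α₂ : D₂ →o Q} {X₁ X₂ : Q ⥤ C}
    [HasBinaryBiproduct X₁ X₂]
    (h₁ : IsDiscretizedBy X₁ α₁) (h₂ : IsDiscretizedBy X₂ α₂) :
    IsDiscretizedBy (X₁ ⊞ X₂) (sumOrderHom α₁ α₂) := by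
  obtain ⟨Y₁, η₁, h₁⟩ := h₁
  obtain ⟨Y₂, η₂, h₂⟩ := h₂
  let η : sumFunctor Y₁ Y₂ ⟶ (sumOrderHom α₁ α₂).monotone.functor ⋙ (X₁ ⊞ X₂) :=
    { app := fun a => match a with
        | .inl d => η₁.app d ≫ (biprod.inl : X₁ ⟶ X₁ ⊞ X₂).app (α₁ d)
        | .inr d => η₂.app d ≫ (biprod.inr : X₂ ⟶ X₁ ⊞ X₂).app (α₂ d)
      naturality := fun a b f => match a, b, f with
        | .inl _, .inr _, f => (DisjointUnion.not_inl_le_inr f.le).elim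
        | .inr _, .inl _, f => (DisjointUnion.not_inr_le_inl f.le).elim
        | .inl _, .inl _, f =>
          (η₁ ≫ Functor.whiskerLeft _ (biprod.inl : X₁ ⟶ X₁ ⊞ X₂)).naturality
            (homOfLE (DisjointUnion.inl_le_inl_iff.1 f.le))
        | .inr _, .inr _, f =>
          (η₂ ≫ Functor.whiskerLeft _ (biprod.inr : X₂ ⟶ X₁ ⊞ X₂)).naturality
            (homOfLE (DisjointUnion.inr_le_inr_iff.1 f.le)) }
  refine ⟨_, η, isLeftKanExtension_of_existsUnique _ (fun M β => ?_) (fun M γ γ' h => ?_)⟩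
  · let β₁ : Y₁ ⟶ α₁.monotone.functor ⋙ M :=
      { app := fun d => β.app (.inl d)
        naturality := fun a b f => β.naturality (homOfLE (DisjointUnion.inl_le_inl_iff.2 f.le)) }
    let β₂ : Y₂ ⟶ α₂.monotone.functor ⋙ M :=
      { app := fun d => β.app (.inr d)
        naturality := fun a b f => β.naturality (homOfLE (DisjointUnion.inr_le_inr_iff.2 f.le)) }
    refine ⟨biprod.desc (X₁.descOfIsLeftKanExtension η₁ M β₁)
      (X₂.descOfIsLeftKanExtension η₂ M β₂), fun d => ?_⟩
    match d with
    | .inl d =>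
      refine Eq.trans ?_ (X₁.descOfIsLeftKanExtension_fac_app η₁ M β₁ d)
      refine (Category.assoc _ _ _).trans (congrArg (η₁.app d ≫ ·) ?_)
      exact congr_app (biprod.inl_desc (X₁.descOfIsLeftKanExtension η₁ M β₁)
        (X₂.descOfIsLeftKanExtension η₂ M β₂)) (α₁ d)
    | .inr d =>
      refine Eq.trans ?_ (X₂.descOfIsLeftKanExtension_fac_app η₂ M β₂ d)
      refine (Category.assoc _ _ _).trans (congrArg (η₂.app d ≫ ·) ?_)
      exact congr_app (biprod.inr_desc (X₁.descOfIsLeftKanExtension η₁ M β₁)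
        (X₂.descOfIsLeftKanExtension η₂ M β₂)) (α₂ d)
  · refine biprod.hom_ext' _ _ (X₁.hom_ext_of_isLeftKanExtension η₁ _ _ ?_)
      (X₂.hom_ext_of_isLeftKanExtension η₂ _ _ ?_)
    · ext d
      exact (Category.assoc _ _ _).symm.trans ((h (.inl d)).trans (Category.assoc _ _ _))
    · ext d
      exact (Category.assoc _ _ _).symm.trans ((h (.inr d)).trans (Category.assoc _ _ _))

end Sum

end Kan

/-! ### Closure of tame functors under kernels, cokernels and finite products. -/

section Closure

open ZeroObject

variable {Q : Type u} [PartialOrder Q] {C : Type w} [Category.{v} C] [Abelian C]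

lemma isTame_biprod {X₁ X₂ : Q ⥤ C} (h₁ : isTame Q C X₁) (h₂ : isTame Q C X₂) :
    isTame Q C (X₁ ⊞ X₂) := by
  obtain ⟨D₁, _, α₁, _, h₁⟩ := h₁
  obtain ⟨D₂, _, α₂, _, h₂⟩ := h₂
  exact ⟨DisjointUnion D₁ D₂, inferInstance, sumOrderHom α₁ α₂, inferInstance, h₁.biprod h₂⟩

variable (Q C) in
lemma containsZero_isTame : (isTame Q C).ContainsZero where
  exists_zero := by
    have h : IsZero ((Functor.const Q).obj (0 : C)) := Functor.isZero _ fun _ => isZero_zero C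
    exact ⟨_, h, IsConstructible.isTame Set.finite_empty (fun _ _ h => h.elim)
      ⟨fun _ _ => isZero_zero C, fun _ _ _ h => h.1.1.elim⟩⟩

lemma exists_isConstructible (hQ : TameDiscretizableByTransfers Q C)
    {X : Q ⥤ C} (hX : isTame Q C X) :
    ∃ S : Set Q, S.Finite ∧ HasFloors S ∧ IsConstructible S X := by
  obtain ⟨D, _, α, _, hα, h⟩ := hQ X hX
  exact ⟨Set.range α, Set.finite_range α, hα.hasFloors, hα.isConstructible h⟩

/-- The union of two sets with floors need not have floors. A set for the biproduct works for both
summands, which are retracts of it. -/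
lemma exists_isConstructible_pair (hQ : TameDiscretizableByTransfers Q C) {X Y : Q ⥤ C}
    (hX : isTame Q C X) (hY : isTame Q C Y) :
    ∃ S : Set Q, S.Finite ∧ HasFloors S ∧ IsConstructible S X ∧ IsConstructible S Y := by
  obtain ⟨S, h₁, h₂, h₃⟩ := exists_isConstructible hQ (isTame_biprod hX hY)
  exact ⟨S, h₁, h₂, h₃.of_retract ⟨biprod.inl, biprod.fst, by simp⟩,
    h₃.of_retract ⟨biprod.inr, biprod.snd, by simp⟩⟩

lemma isClosedUnderKernels_isTame (hQ : TameDiscretizableByTransfers Q C) :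
    (isTame Q C).IsClosedUnderKernels where
  kernels_le := by
    rintro _ ⟨f, k, hk, hf⟩
    obtain ⟨S, h₁, h₂, h₃, h₄⟩ := exists_isConstructible_pair hQ hf.1 hf.2
    exact (IsConstructible.of_isLimit hk (by rintro (_ | _); exacts [h₃, h₄])).isTame h₁ h₂

lemma isClosedUnderCokernels_isTame (hQ : TameDiscretizableByTransfers Q C) :
    (isTame Q C).IsClosedUnderCokernels where
  cokernels_le := by
    rintro _ ⟨f, k, hk, hf⟩
    obtain ⟨S, h₁, h₂, h₃, h₄⟩ := exists_isConstructible_pair hQ hf.1 hf.2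
    exact (IsConstructible.of_isColimit hk (by rintro (_ | _); exacts [h₃, h₄])).isTame h₁ h₂

lemma isClosedUnderFiniteProducts_isTame (hQ : TameDiscretizableByTransfers Q C) :
    (isTame Q C).IsClosedUnderFiniteProducts := by
  have := containsZero_isTame Q C
  have : (isTame Q C).IsClosedUnderIsomorphisms :=
    { of_iso := fun e hX => by
        obtain ⟨S, h₁, h₂, h₃⟩ := exists_isConstructible hQ hX
        exact (h₃.of_retract (.ofIso e.symm)).isTame h₁ h₂ }
  have : (isTame Q C).IsClosedUnderBinaryProducts :=
    { limitsOfShape_le := by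
        rintro X ⟨p⟩
        obtain ⟨S, h₁, h₂, h₃, h₄⟩ := exists_isConstructible_pair hQ
          (p.prop_diag_obj (.mk .left)) (p.prop_diag_obj (.mk .right))
        exact (IsConstructible.of_isLimit p.isLimit
          (by rintro ⟨_ | _⟩; exacts [h₃, h₄])).isTame h₁ h₂ }
  exact .mk'

end Closure

section Generated

variable {Q : Type u} [PartialOrder Q] {C : Type w} [Category.{v} C] {S : Set Q}

lemma IsConstructible.hom_ext {X : Q ⥤ C} (hS : HasFloors S) (hX : IsConstructible S X) {q : Q}
    {Z : C} {f g : X.obj q ⟶ Z}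
    (h : ∀ s ∈ S, ∀ hs : s ≤ q, X.map (homOfLE hs) ≫ f = X.map (homOfLE hs) ≫ g) : f = g := by
  by_cases hq : ∃ s ∈ S, s ≤ q
  · obtain ⟨s, hs, hsq⟩ := hq
    obtain ⟨t, ht⟩ := hS q s hs hsq
    have htq : t ≤ q := ht.1.2
    have : IsIso (X.map (homOfLE htq)) := hX.isIso t q htq ht
    rw [← cancel_epi (X.map (homOfLE htq))]
    exact h t ht.1.1 htq
  · push Not at hq
    exact (hX.isZero q hq).eq_of_src _ _

end Generated

/-! ### Free functors. -/

section Free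

variable {Q : Type u} [PartialOrder Q] {C : Type w} [Category.{v} C] [Abelian C]
  {I : Type*} [Finite I]

instance : HasFiniteBiproducts C := Abelian.hasFiniteBiproducts

/-- The free functor `Q ⥤ C` on a finite family of objects `A i` placed at the elements `t i`. -/
noncomputable def free (t : I → Q) (A : I → C) : Q ⥤ C where
  obj q := ⨁ fun p : {i // t i ≤ q} => A p.1
  map {q q'} f := biproduct.desc fun p =>
    biproduct.ι (fun p : {i // t i ≤ q'} => A p.1) ⟨p.1, p.2.trans f.le⟩
  map_id q := biproduct.hom_ext' _ _ fun p => by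
    rw [biproduct.ι_desc]
    exact (Category.comp_id _).symm
  map_comp f g := biproduct.hom_ext' _ _ fun p => by
    rw [biproduct.ι_desc, biproduct.ι_desc_assoc, biproduct.ι_desc]

namespace free

variable {t : I → Q} {A : I → C}

variable (t A) in
/-- The inclusion of a generating object in the value of a free functor. -/
noncomputable def incl (i : I) {q : Q} (h : t i ≤ q) : A i ⟶ (free t A).obj q :=
  biproduct.ι (fun p : {i // t i ≤ q} => A p.1) ⟨i, h⟩

lemma incl_map (i : I) {q q' : Q} (h : t i ≤ q) (f : q ⟶ q') :
    incl t A i h ≫ (free t A).map f = incl t A i (h.trans f.le) :=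
  biproduct.ι_desc (fun p : {i // t i ≤ q} => biproduct.ι (fun p : {i // t i ≤ q'} => A p.1)
    ⟨p.1, p.2.trans f.le⟩) ⟨i, h⟩

lemma obj_hom_ext {q : Q} {Z : C} {f g : (free t A).obj q ⟶ Z}
    (h : ∀ i (hi : t i ≤ q), incl t A i hi ≫ f = incl t A i hi ≫ g) : f = g :=
  biproduct.hom_ext' _ _ fun p => h p.1 p.2

/-- A morphism from the value of a free functor is given by its restrictions to the generating
objects. -/
noncomputable def objDesc {q : Q} {Z : C} (f : ∀ i, t i ≤ q → (A i ⟶ Z)) :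
    (free t A).obj q ⟶ Z :=
  biproduct.desc fun p => f p.1 p.2

lemma incl_objDesc {q : Q} {Z : C} (f : ∀ i, t i ≤ q → (A i ⟶ Z)) (i : I) (h : t i ≤ q) :
    incl t A i h ≫ objDesc f = f i h :=
  biproduct.ι_desc (fun p : {i // t i ≤ q} => f p.1 p.2) ⟨i, h⟩

/-- A morphism from a free functor is given by its restrictions to the generating objects. -/
noncomputable def desc {X : Q ⥤ C} (φ : ∀ i, A i ⟶ X.obj (t i)) : free t A ⟶ X where
  app q := objDesc fun i h => φ i ≫ X.map (homOfLE h)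
  naturality q q' f := obj_hom_ext fun i h => by
    rw [← Category.assoc, incl_map, incl_objDesc, ← Category.assoc, incl_objDesc, Category.assoc,
      ← X.map_comp]
    rfl

lemma incl_desc_app {X : Q ⥤ C} (φ : ∀ i, A i ⟶ X.obj (t i)) (i : I) {q : Q} (h : t i ≤ q) :
    incl t A i h ≫ (desc φ).app q = φ i ≫ X.map (homOfLE h) :=
  incl_objDesc (fun i h => φ i ≫ X.map (homOfLE h)) i h

lemma incl_desc_app_self {X : Q ⥤ C} (φ : ∀ i, A i ⟶ X.obj (t i)) (i : I) :
    incl t A i le_rfl ≫ (desc φ).app (t i) = φ i := by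
  rw [incl_desc_app]
  exact (congrArg (φ i ≫ ·) (X.map_id _)).trans (Category.comp_id _)

lemma hom_ext {X : Q ⥤ C} {f g : free t A ⟶ X}
    (h : ∀ i, incl t A i le_rfl ≫ f.app (t i) = incl t A i le_rfl ≫ g.app (t i)) : f = g := by
  ext q
  refine obj_hom_ext fun i hi => ?_
  have : incl t A i hi = incl t A i le_rfl ≫ (free t A).map (homOfLE hi) :=
    (incl_map i le_rfl _).symm
  rw [this, Category.assoc, Category.assoc, f.naturality, g.naturality, reassoc_of% h i]

/-- The value at `q` of the morphism of free functors given by a family of morphisms. -/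
noncomputable def objMap {B : I → C} (a : ∀ i, A i ⟶ B i) (q : Q) :
    (free t A).obj q ⟶ (free t B).obj q :=
  biproduct.map fun p => a p.1

lemma incl_objMap {B : I → C} (a : ∀ i, A i ⟶ B i) (i : I) {q : Q} (h : t i ≤ q) :
    incl t A i h ≫ objMap a q = a i ≫ incl t B i h :=
  biproduct.ι_map (fun p : {i // t i ≤ q} => a p.1) ⟨i, h⟩

/-- The free functor is functorial in the family of objects. -/
noncomputable def map {B : I → C} (a : ∀ i, A i ⟶ B i) : free t A ⟶ free t B where
  app := objMap a
  naturality q q' f := obj_hom_ext fun i h => by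
    rw [← Category.assoc, incl_map, incl_objMap, ← Category.assoc, incl_objMap, Category.assoc,
      incl_map]

lemma incl_map_app {B : I → C} (a : ∀ i, A i ⟶ B i) (i : I) {q : Q} (h : t i ≤ q) :
    incl t A i h ≫ (map a).app q = a i ≫ incl t B i h :=
  incl_objMap a i h

instance {B : I → C} (a : ∀ i, A i ⟶ B i) [∀ i, Mono (a i)] (q : Q) :
    Mono ((map a : free t A ⟶ _).app q) :=
  inferInstanceAs (Mono (biproduct.map fun p : {i // t i ≤ q} => a p.1))

instance {B : I → C} (a : ∀ i, A i ⟶ B i) [∀ i, Epi (a i)] (q : Q) :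
    Epi ((map a : free t A ⟶ _).app q) :=
  inferInstanceAs (Epi (biproduct.map fun p : {i // t i ≤ q} => a p.1))

/-- Maps out of `free t A` are families of maps `A i ⟶ X.obj (t i)`, and epimorphisms of functors
are pointwise. -/
lemma projective [∀ i, Projective (A i)] : Projective (free t A) where
  factors {E X} f e he := by
    have : ∀ q, Epi (e.app q) := fun q => inferInstance
    refine ⟨desc fun i => Projective.factorThru (incl t A i le_rfl ≫ f.app (t i)) (e.app (t i)),
      hom_ext fun i => ?_⟩
    rw [NatTrans.comp_app, ← Category.assoc, incl_desc_app_self, Projective.factorThru_comp]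

lemma isTame {I : Type u} [Finite I] (t : I → Q) (A : I → C) : isTame Q C (free t A) := by
  -- With the discrete order on `I`, the free functor is the left Kan extension of `A` along `t`.
  let _ : PartialOrder I :=
    { le := Eq, le_refl := fun _ => rfl, le_trans := fun _ _ _ => Eq.trans
      le_antisymm := fun _ _ h _ => h }
  let α : I →o Q := ⟨t, fun i j h => (show i = j from h) ▸ le_rfl⟩
  let Y : I ⥤ C :=
    { obj := A
      map := fun {i j} f => eqToHom (congrArg A (show i = j from f.le)) }
  have hY : ∀ {i j : I} (f : i ⟶ j), i = j := fun f => f.le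
  let η : Y ⟶ α.monotone.functor ⋙ free t A :=
    { app := fun i => incl t A i le_rfl
      naturality := fun i j f => by
        obtain rfl := hY f
        obtain rfl : f = 𝟙 i := Subsingleton.elim _ _
        refine (congrArg (· ≫ incl t A i le_rfl) (Y.map_id i)).trans ((Category.id_comp _).trans ?_)
        exact ((congrArg (incl t A i le_rfl ≫ ·) ((free t A).map_id (t i))).trans
          (Category.comp_id _)).symm }
  refine ⟨I, inferInstance, α, ‹_›, Y, η, isLeftKanExtension_of_existsUnique _
    (fun M β => ⟨desc fun i => β.app i, fun i => incl_desc_app_self _ i⟩)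
    (fun M γ γ' h => hom_ext h)⟩

end free

end Free

/-! ### Top parts, Nakayama's lemma and minimal covers. -/

section TopPart

variable {Q : Type u} [PartialOrder Q] {C : Type w} [Category.{v} C] [Abelian C]

lemma IsConstructible.epi_of_epi_app {S : Set Q} (hS : HasFloors S) {X Z : Q ⥤ C}
    (hX : IsConstructible S X) (φ : Z ⟶ X) (h : ∀ s ∈ S, Epi (φ.app s)) : Epi φ := by
  have : ∀ q, Epi (φ.app q) := fun q => Preadditive.epi_of_cancel_zero _ fun f hf =>
    hX.hom_ext hS fun s hs hsq => by
      have := h s hs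
      rw [← cancel_epi (φ.app s), ← Category.assoc, ← φ.naturality, Category.assoc, hf, comp_zero,
        comp_zero, comp_zero]
  exact NatTrans.epi_of_epi_app φ

variable (S : Set Q) [Finite S]

/-- The quotient of the value of `X` at `s` by the images of its values at the elements of `S`
below `s`. -/
noncomputable def topPart (s : Q) (X : Q ⥤ C) : C :=
  cokernel (biproduct.desc fun t : {t : S // (t : Q) < s} => X.map (homOfLE t.2.le))

namespace topPart

/-- The projection to the quotient. -/
noncomputable def proj (s : Q) (X : Q ⥤ C) : X.obj s ⟶ topPart S s X :=
  cokernel.π _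

instance (s : Q) (X : Q ⥤ C) : Epi (proj S s X) :=
  inferInstanceAs (Epi (cokernel.π _))

variable {S}

lemma map_proj {s t : Q} (ht : t ∈ S) (h : t < s) (X : Q ⥤ C) :
    X.map (homOfLE h.le) ≫ proj S s X = 0 := by
  have := congrArg (biproduct.ι (fun t : {t : S // (t : Q) < s} => X.obj t) ⟨⟨t, ht⟩, h⟩ ≫ ·)
    (cokernel.condition
      (biproduct.desc fun t : {t : S // (t : Q) < s} => X.map (homOfLE t.2.le)))
  dsimp only at this
  rw [biproduct.ι_desc_assoc, comp_zero] at this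
  exact this

/-- The universal property of the quotient. -/
noncomputable def desc {s : Q} {X : Q ⥤ C} {Z : C} (f : X.obj s ⟶ Z)
    (hf : ∀ t ∈ S, ∀ h : t < s, X.map (homOfLE h.le) ≫ f = 0) : topPart S s X ⟶ Z :=
  cokernel.desc _ f (biproduct.hom_ext' _ _ fun t => by
    rw [biproduct.ι_desc_assoc, comp_zero, hf t t.1.2 t.2])

lemma proj_desc {s : Q} {X : Q ⥤ C} {Z : C} (f : X.obj s ⟶ Z)
    (hf : ∀ t ∈ S, ∀ h : t < s, X.map (homOfLE h.le) ≫ f = 0) : proj S s X ≫ desc f hf = f :=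
  cokernel.π_desc _ _ _

variable (S) in
/-- The quotient is functorial. -/
noncomputable def map (s : Q) {X Y : Q ⥤ C} (f : X ⟶ Y) : topPart S s X ⟶ topPart S s Y :=
  desc (f.app s ≫ proj S s Y) fun t ht h => by
    rw [f.naturality_assoc, map_proj ht h, comp_zero]

lemma proj_map (s : Q) {X Y : Q ⥤ C} (f : X ⟶ Y) :
    proj S s X ≫ map S s f = f.app s ≫ proj S s Y :=
  proj_desc _ _

lemma map_id (s : Q) (X : Q ⥤ C) : map S s (𝟙 X) = 𝟙 _ := by
  rw [← cancel_epi (proj S s X), proj_map, NatTrans.id_app, Category.id_comp, Category.comp_id]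

lemma map_comp (s : Q) {X Y Z : Q ⥤ C} (f : X ⟶ Y) (g : Y ⟶ Z) :
    map S s (f ≫ g) = map S s f ≫ map S s g := by
  rw [← cancel_epi (proj S s X), proj_map, ← Category.assoc, proj_map, Category.assoc, proj_map,
    NatTrans.comp_app, Category.assoc]

end topPart

variable {S}

/-- A form of Nakayama's lemma for constructible functors. -/
lemma IsConstructible.epi_of_epi_topPart (hS : HasFloors S) {X Z : Q ⥤ C}
    (hX : IsConstructible S X) (φ : Z ⟶ X)
    (h : ∀ s : S, Epi (φ.app s ≫ topPart.proj S s X)) : Epi φ := by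
  suffices H : ∀ s : S, Epi (φ.app s) from
    hX.epi_of_epi_app hS φ fun s hs => H ⟨s, hs⟩
  intro s
  induction s using WellFoundedLT.induction with
  | ind s ih =>
    refine Preadditive.epi_of_cancel_zero _ fun f hf => ?_
    -- By induction `φ` is epi at every lower `t` in `S`, so `f` kills the images from below and
    -- factors through the top part, where it vanishes by `h`.
    have hf' : ∀ t ∈ S, ∀ h : t < s, X.map (homOfLE h.le) ≫ f = 0 := fun t ht hts => by
      have : Epi (φ.app t) := ih ⟨t, ht⟩ hts
      rw [← cancel_epi (φ.app t), ← Category.assoc, ← φ.naturality, Category.assoc, hf,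
        comp_zero, comp_zero]
    have := h s
    have h0 : topPart.desc f hf' = 0 := by
      rw [← cancel_epi (φ.app s ≫ topPart.proj S s X), Category.assoc, topPart.proj_desc, hf,
        comp_zero]
    rw [← topPart.proj_desc f hf', h0, comp_zero]

/-- If `s` is the floor of `q`, the same generators lie below `s` and below `q`. -/
lemma free.isConstructible (A : S → C) :
    IsConstructible S (free (Subtype.val : S → Q) A) where
  isZero q hq := (IsZero.iff_id_eq_zero _).2 (free.obj_hom_ext fun i h => absurd h (hq i i.2))
  isIso s q h hs := by
    refine ⟨free.objDesc fun i hi => free.incl _ A i (hs.2 ⟨i.2, hi⟩), ?_, ?_⟩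
    · refine free.obj_hom_ext fun i hi => ?_
      rw [← Category.assoc, free.incl_map, free.incl_objDesc, Category.comp_id]
    · refine free.obj_hom_ext fun i hi => ?_
      rw [← Category.assoc, free.incl_objDesc, free.incl_map, Category.comp_id]

/-- Every summand at `s` other than `A s` comes from a strictly lower element, so it dies in the top
part; the inverse is induced by the projection `g`. -/
lemma free.isIso_incl_proj (A : S → C) (s : S) :
    IsIso (free.incl Subtype.val A s le_rfl ≫ topPart.proj S s (free Subtype.val A)) := by
  classical
  let g : (free Subtype.val A).obj (s : Q) ⟶ A s :=
    free.objDesc fun i _ => if h : i = s then eqToHom (congrArg A h) else 0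
  refine ⟨topPart.desc g fun t ht h => free.obj_hom_ext fun i hi => ?_, ?_, ?_⟩
  · have : i ≠ s := fun h' => (h'.symm ▸ hi).not_gt h
    rw [← Category.assoc, free.incl_map, free.incl_objDesc, dif_neg this, comp_zero]
  · rw [Category.assoc, topPart.proj_desc, free.incl_objDesc, dif_pos rfl, eqToHom_refl]
  · rw [← cancel_epi (topPart.proj S s _), ← Category.assoc, topPart.proj_desc, Category.comp_id]
    refine free.obj_hom_ext fun i hi => ?_
    rw [← Category.assoc, free.incl_objDesc]
    split_ifs with h
    · subst h
      rw [eqToHom_refl, Category.id_comp]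
    · have hlt : (i : Q) < s := lt_of_le_of_ne hi fun h' => h (Subtype.ext h')
      have : free.incl Subtype.val A i hi =
          free.incl Subtype.val A i le_rfl ≫ (free Subtype.val A).map (homOfLE hlt.le) :=
        (free.incl_map i le_rfl _).symm
      rw [this, Category.assoc, topPart.map_proj i.2 hlt, zero_comp, comp_zero]

lemma IsConstructible.exists_projective_epi [EnoughProjectives C] (hS : HasFloors S) {X : Q ⥤ C}
    (hX : IsConstructible S X) :
    ∃ (A : S → C) (f : free (Subtype.val : S → Q) A ⟶ X), (∀ s, Projective (A s)) ∧ Epi f := by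
  let f : free (Subtype.val : S → Q) (fun s => Projective.over (X.obj s)) ⟶ X :=
    free.desc fun s => Projective.π (X.obj s)
  refine ⟨_, f, fun s => inferInstance, hX.epi_of_epi_app hS f fun s hs => ?_⟩
  have : Epi (free.incl (Subtype.val : S → Q) (fun s => Projective.over (X.obj s)) ⟨s, hs⟩ le_rfl ≫
      f.app s) := by
    have := free.incl_desc_app_self (fun s : S => Projective.π (X.obj s)) ⟨s, hs⟩
    rw [this]
    infer_instance
  exact epi_of_epi (free.incl (Subtype.val : S → Q) (fun s => Projective.over (X.obj s))
    ⟨s, hs⟩ le_rfl) (f.app s)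

/-- Minimal covers of the top parts lift to `X` by projectivity, and together they define the cover
`f`. On top parts `f` recovers the chosen covers, so an endomorphism over `X` is invertible there by
minimality. -/
lemma IsConstructible.exists_minimal_cover (hC : MinimalCoverAxiom C) (hS : HasFloors S)
    {X : Q ⥤ C} (hX : IsConstructible S X) :
    ∃ (A : S → C) (f : free (Subtype.val : S → Q) A ⟶ X),
      (∀ s, Projective (A s)) ∧ Epi f ∧ IsMinimalMorphism f := by
  choose A p hA hp hmin using fun s : S => hC (topPart S s X)
  let F := free (Subtype.val : S → Q) A
  let l : ∀ s : S, A s ⟶ X.obj s := fun s => Projective.factorThru (p s) (topPart.proj S s X)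
  let f : F ⟶ X := free.desc l
  have hF : IsConstructible S F := free.isConstructible A
  have hproj : Projective F := free.projective
  have hl : ∀ s, free.incl Subtype.val A s le_rfl ≫ f.app s ≫ topPart.proj S s X = p s := by
    intro s
    have := free.incl_desc_app_self l s
    rw [← Category.assoc, this]
    exact Projective.factorThru_comp _ _
  obtain ⟨a, ha, haf⟩ : ∃ a : ∀ s : S, A s ⟶ topPart S s F, (∀ s, IsIso (a s)) ∧
      ∀ s, a s ≫ topPart.map S s f = p s :=
    ⟨fun s => free.incl Subtype.val A s le_rfl ≫ topPart.proj S s F, free.isIso_incl_proj A,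
      fun s => by rw [Category.assoc, topPart.proj_map, hl]⟩
  have nakayama : ∀ ψ : F ⟶ F, (∀ s : S, IsIso (topPart.map S s ψ)) → Epi ψ := fun ψ hψ =>
    hF.epi_of_epi_topPart hS ψ fun s => by
      rw [← topPart.proj_map]
      infer_instance
  refine ⟨A, f, hA, hX.epi_of_epi_topPart hS f fun s => ?_, fun φ hφ => ?_⟩
  · have : Epi (free.incl Subtype.val A s le_rfl ≫ f.app s ≫ topPart.proj S s X) := by
      rw [hl]
      infer_instance
    exact epi_of_epi (free.incl Subtype.val A s le_rfl) (f.app s ≫ topPart.proj S s X)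
  · have hφ' : ∀ s : S, IsIso (topPart.map S s φ) := fun s => by
      have h1 : (a s ≫ topPart.map S s φ ≫ inv (a s)) ≫ p s = p s := by
        rw [← haf s, Category.assoc, Category.assoc, IsIso.inv_hom_id_assoc, ← topPart.map_comp, hφ]
      have h2 := hmin s _ h1
      have h3 : topPart.map S s φ =
          inv (a s) ≫ (a s ≫ topPart.map S s φ ≫ inv (a s)) ≫ a s := by simp
      rw [h3]
      infer_instance
    have := nakayama φ hφ'
    -- Nakayama gives only epimorphisms. The section `ψ` of `φ` is also invertible on top parts,
    -- hence epi; being split mono, it is an isomorphism, and so is `φ`.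
    let ψ : F ⟶ F := Projective.factorThru (𝟙 F) φ
    have hψ : ψ ≫ φ = 𝟙 F := Projective.factorThru_comp _ _
    have hψ' : ∀ s : S, IsIso (topPart.map S s ψ) := fun s => by
      have h1 : topPart.map S s ψ ≫ topPart.map S s φ = 𝟙 _ := by
        rw [← topPart.map_comp, hψ, topPart.map_id]
      rw [← IsIso.eq_comp_inv, Category.id_comp] at h1
      rw [h1]
      infer_instance
    have := nakayama ψ hψ'
    have : IsSplitMono ψ := ⟨⟨φ, hψ⟩⟩
    have : IsIso ψ := isIso_of_mono_of_epi ψ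
    rw [← IsIso.eq_inv_comp, Category.comp_id] at hψ
    rw [hψ]
    infer_instance

end TopPart

/-! ### Projective covers inside the category of tame functors. -/

section Tame

variable {Q : Type u} [PartialOrder Q] {C : Type w} [Category.{v} C] [Abelian C]
  [(isTame Q C).ContainsZero] [(isTame Q C).IsClosedUnderCokernels]

lemma projective_of_projective_obj (P : Tame Q C) [Projective P.obj] : Projective P where
  factors {E X} f e he := by
    -- Closure under cokernels makes epimorphisms of tame functors epimorphisms of functors, so
    -- lifts can be taken in `Q ⥤ C`.
    have := (isTame Q C).preservesEpimorphisms_ι_of_isNormalMonoCategory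
    have : Epi e.hom := inferInstanceAs (Epi ((isTame Q C).ι.map e))
    exact ⟨(isTame Q C).homMk (Projective.factorThru f.hom e.hom), by ext1; simp⟩

/-- The free functor as a tame functor. -/
noncomputable abbrev tameFree {I : Type u} [Finite I] (t : I → Q) (A : I → C) : Tame Q C :=
  ⟨free t A, free.isTame t A⟩

lemma tameFree.projective {I : Type u} [Finite I] (t : I → Q) (A : I → C)
    [∀ i, Projective (A i)] : Projective (tameFree t A) :=
  have : Projective (tameFree t A).obj := free.projective
  projective_of_projective_obj _

lemma enoughProjectives_tame (hQ : TameDiscretizableByTransfers Q C) [EnoughProjectives C] :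
    EnoughProjectives (Tame Q C) where
  presentation X := by
    obtain ⟨S, h₁, h₂, h₃⟩ := exists_isConstructible hQ X.property
    have := h₁.to_subtype
    obtain ⟨A, f, hA, hf⟩ := h₃.exists_projective_epi h₂
    exact ⟨{
      p := tameFree Subtype.val A
      projective := tameFree.projective _ _
      f := (isTame Q C).homMk f
      epi := (isTame Q C).ι.epi_of_epi_map hf }⟩

lemma minimalCoverAxiom_tame (hQ : TameDiscretizableByTransfers Q C) (hC : MinimalCoverAxiom C) :
    MinimalCoverAxiom (Tame Q C) := by
  intro X
  obtain ⟨S, h₁, h₂, h₃⟩ := exists_isConstructible hQ X.property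
  have := h₁.to_subtype
  obtain ⟨A, f, hA, hf, hmin⟩ := h₃.exists_minimal_cover hC h₂
  refine ⟨tameFree Subtype.val A, (isTame Q C).homMk f, tameFree.projective _ _,
    (isTame Q C).ι.epi_of_epi_map hf, fun φ hφ => ?_⟩
  have : IsIso ((isTame Q C).ι.map φ) := hmin φ.hom (congrArg (·.hom) hφ)
  exact isIso_of_reflects_iso φ (isTame Q C).ι

end Tame

/-! ### Lengths of resolutions and `HasProjectiveDimensionLT`. -/

section ProjectiveDimension

variable {C : Type w} [Category.{v} C] [Abelian C]

lemma resolutionLength_le_iff {X : C} (P : ProjectiveResolution X) (n : ℕ) :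
    resolutionLength P ≤ n ↔ ∀ k, n < k → IsZero (P.complex.X k) := by
  constructor
  · intro h k hk
    have hne : {n : ℕ∞ | ∀ k : ℕ, n < k → IsZero (P.complex.X k)}.Nonempty :=
      ⟨⊤, fun k hk => absurd hk not_top_lt⟩
    -- Infima of nonempty sets in `ℕ∞` are attained.
    exact csInf_mem hne k (h.trans_lt (by exact_mod_cast hk))
  · exact fun h => sInf_le fun k hk => h k (by exact_mod_cast hk)

lemma projDim_le_iff (X : C) [Nonempty (ProjectiveResolution X)] (n : ℕ) :
    projDim X ≤ n ↔
      ∃ P : ProjectiveResolution X, ∀ k, n < k → IsZero (P.complex.X k) := by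
  constructor
  · intro h
    obtain ⟨P, hP⟩ : ∃ P : ProjectiveResolution X, resolutionLength P = projDim X :=
      csInf_mem (Set.range_nonempty _)
    exact ⟨P, (resolutionLength_le_iff P n).1 (hP.le.trans h)⟩
  · rintro ⟨P, hP⟩
    exact (iInf_le _ P).trans ((resolutionLength_le_iff P n).2 hP)

/-- Dimension shifting: the cokernels of consecutive differentials are the outer terms of short
exact sequences with middle term `P_k`. The induction descends from `k = n`, where the cokernel is
`P_n`, to `k = 0`, where it is `X`. -/
lemma hasProjectiveDimensionLT_of_resolution {X : C} (P : ProjectiveResolution X) (n : ℕ)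
    (hP : ∀ k, n < k → IsZero (P.complex.X k)) : HasProjectiveDimensionLT X (n + 1) := by
  have key : ∀ m k, m + k = n →
      HasProjectiveDimensionLT (cokernel (P.complex.d (k + 1) k)) (m + 1) := by
    intro m
    induction m with
    | zero =>
      rintro k hk
      have h0 : P.complex.d (k + 1) k = 0 := (hP _ (by omega)).eq_of_src _ _
      have : IsIso (cokernel.π (P.complex.d (k + 1) k)) := by
        rw [h0]
        infer_instance
      have : Projective (cokernel (P.complex.d (k + 1) k)) :=
        Projective.of_iso (asIso (cokernel.π (P.complex.d (k + 1) k))) inferInstance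
      infer_instance
    | succ m ih =>
      intro k hk
      have h1 := ih (k + 1) (by omega)
      let S : ShortComplex C := ShortComplex.mk
        (cokernel.desc (P.complex.d (k + 2) (k + 1)) (P.complex.d (k + 1) k) (by simp))
        (cokernel.π (P.complex.d (k + 1) k)) (by
          rw [← cancel_epi (cokernel.π _)]
          simp)
      have hS : S.ShortExact := by
        have : Epi S.g := inferInstanceAs (Epi (cokernel.π _))
        have : Mono S.f := (P.exact_succ k).mono_cokernelDesc
        refine ⟨?_⟩
        let φ : ShortComplex.mk (P.complex.d (k + 1) k) (cokernel.π (P.complex.d (k + 1) k))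
            (by simp) ⟶ S :=
          { τ₁ := cokernel.π _, τ₂ := 𝟙 _, τ₃ := 𝟙 _
            comm₁₂ := by simp [S], comm₂₃ := by simp [S] }
        have : Epi φ.τ₁ := inferInstanceAs (Epi (cokernel.π _))
        have : IsIso φ.τ₂ := inferInstanceAs (IsIso (𝟙 _))
        have : Mono φ.τ₃ := inferInstanceAs (Mono (𝟙 _))
        rw [← ShortComplex.exact_iff_of_epi_of_isIso_of_mono φ]
        exact ShortComplex.exact_of_g_is_cokernel _ (cokernelIsCokernel _)
      have : Projective S.X₂ := P.projective k
      exact hS.hasProjectiveDimensionLT_X₃ _ h1 inferInstance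
  let e : cokernel (P.complex.d 1 0) ≅ X :=
    IsColimit.coconePointUniqueUpToIso (cokernelIsCokernel _) P.isColimitCokernelCofork
  have : HasProjectiveDimensionLT (cokernel (P.complex.d 1 0)) (n + 1) := key n 0 rfl
  exact hasProjectiveDimensionLT_of_iso e _

/-- A complex of projective objects that is exact in positive degrees is a projective resolution
of its cokernel in degree zero. -/
noncomputable def projectiveResolutionOfExact (K : ChainComplex C ℕ) (hK : ∀ n, Projective (K.X n))
    {X : C} (f : K.X 0 ⟶ X) (w : K.d 1 0 ≫ f = 0) (hf : Epi f)
    (h₀ : (ShortComplex.mk (K.d 1 0) f w).Exact)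
    (h : ∀ n, (ShortComplex.mk _ _ (K.d_comp_d (n + 2) (n + 1) n)).Exact) :
    ProjectiveResolution X where
  complex := K
  projective := hK
  π := (ChainComplex.toSingle₀Equiv _ _).symm ⟨f, w⟩
  quasiIso := ⟨fun n => by
    cases n
    · rw [ChainComplex.quasiIsoAt₀_iff, ShortComplex.quasiIso_iff_of_zeros']
      · refine (ShortComplex.exact_and_epi_g_iff_of_iso ?_).2 ⟨h₀, hf⟩
        exact ShortComplex.isoMk (Iso.refl _) (Iso.refl _) (Iso.refl _)
          ((Category.id_comp _).trans (Category.comp_id _).symm) (by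
            refine (Category.id_comp _).trans (Eq.trans ?_ (Category.comp_id _).symm)
            exact (ChainComplex.toSingle₀Equiv_symm_apply_f_zero f w).symm)
      · exact K.shape _ _ (by simp)
      all_goals rfl
    · rw [quasiIsoAt_iff_exactAt']
      · rw [HomologicalComplex.exactAt_iff' _ _ _ _ (ChainComplex.prev _ _)
          (ChainComplex.next_nat_succ _)]
        exact h _
      · apply ChainComplex.exactAt_succ_single_obj⟩

/-- Splicing: `S.X₂` becomes degree zero and `R` moves up by one degree. -/
lemma exists_resolution_of_shortExact {S : ShortComplex C} (hS : S.ShortExact)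
    (h₂ : Projective S.X₂) (R : ProjectiveResolution S.X₁) :
    ∃ R' : ProjectiveResolution S.X₃, ∀ k, R'.complex.X (k + 1) = R.complex.X k := by
  have := hS.mono_f
  have := hS.epi_g
  let p : R.complex.X 0 ⟶ S.X₁ := R.π.f 0
  have hp : R.complex.d 1 0 ≫ p = 0 := R.complex_d_comp_π_f_zero
  have hpe : Epi p := inferInstanceAs (Epi (R.π.f 0))
  have hw : R.complex.d 1 0 ≫ p ≫ S.f = 0 := by rw [← Category.assoc, hp, zero_comp]
  refine ⟨projectiveResolutionOfExact (ChainComplex.augment R.complex (p ≫ S.f) hw) ?_ S.g ?_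
    hS.epi_g ?_ ?_, fun k => rfl⟩
  · rintro (_ | n)
    · exact h₂
    · exact R.projective n
  · change (p ≫ S.f) ≫ S.g = 0
    rw [Category.assoc, S.zero, comp_zero]
  · let φ : ShortComplex.mk (p ≫ S.f) S.g (by rw [Category.assoc, S.zero, comp_zero]) ⟶ S :=
      { τ₁ := p, τ₂ := 𝟙 _, τ₃ := 𝟙 _
        comm₁₂ := by simp, comm₂₃ := by simp }
    have : Epi φ.τ₁ := hpe
    have : IsIso φ.τ₂ := inferInstanceAs (IsIso (𝟙 _))
    have : Mono φ.τ₃ := inferInstanceAs (Mono (𝟙 _))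
    exact (ShortComplex.exact_iff_of_epi_of_isIso_of_mono φ).2 hS.exact
  · rintro (_ | n)
    · let φ : ShortComplex.mk (R.complex.d 1 0) p hp ⟶
          ShortComplex.mk (R.complex.d 1 0) (p ≫ S.f) hw :=
        { τ₁ := 𝟙 _, τ₂ := 𝟙 _, τ₃ := S.f
          comm₁₂ := by simp, comm₂₃ := by simp }
      have : Epi φ.τ₁ := inferInstanceAs (Epi (𝟙 _))
      have : IsIso φ.τ₂ := inferInstanceAs (IsIso (𝟙 _))
      have : Mono φ.τ₃ := hS.mono_f
      exact (ShortComplex.exact_iff_of_epi_of_isIso_of_mono φ).1 R.exact₀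
    · exact R.exact_succ n

lemma exists_resolution_of_hasProjectiveDimensionLT [EnoughProjectives C] (n : ℕ) (X : C)
    [HasProjectiveDimensionLT X (n + 1)] :
    ∃ P : ProjectiveResolution X, ∀ k, n < k → IsZero (P.complex.X k) := by
  induction n generalizing X with
  | zero =>
    have : Projective X := projective_iff_hasProjectiveDimensionLT_one.2 ‹_›
    refine ⟨ProjectiveResolution.self X, fun k hk => ?_⟩
    exact HomologicalComplex.isZero_single_obj_X _ _ _ _ hk.ne'
  | succ n ih =>
    let S : ShortComplex C := ShortComplex.mk (kernel.ι (Projective.π X)) (Projective.π X) (by simp)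
    have hS : S.ShortExact :=
      { exact := ShortComplex.exact_of_f_is_kernel _ (kernelIsKernel _)
        mono_f := inferInstanceAs (Mono (kernel.ι _))
        epi_g := inferInstanceAs (Epi (Projective.π X)) }
    have h2 : Projective S.X₂ := Projective.projective_over X
    have : HasProjectiveDimensionLT S.X₁ (n + 1) :=
      (hS.hasProjectiveDimensionLT_X₃_iff n h2).1 ‹_›
    obtain ⟨R, hR⟩ := ih S.X₁
    obtain ⟨R', hR'⟩ := exists_resolution_of_shortExact hS h2 R
    refine ⟨R', fun k hk => ?_⟩
    obtain ⟨k, rfl⟩ : ∃ l, k = l + 1 := ⟨k - 1, by omega⟩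
    rw [hR']
    exact hR k (by omega)

lemma projDim_le_iff_hasProjectiveDimensionLT [EnoughProjectives C] (X : C) (n : ℕ) :
    projDim X ≤ n ↔ HasProjectiveDimensionLT X (n + 1) := by
  have : Nonempty (ProjectiveResolution X) := ⟨ProjectiveResolution.of X⟩
  rw [projDim_le_iff]
  exact ⟨fun ⟨P, hP⟩ => hasProjectiveDimensionLT_of_resolution P n hP,
    fun _ => exists_resolution_of_hasProjectiveDimensionLT n X⟩

lemma catProjDim_le_iff [EnoughProjectives C] (n : ℕ) :
    catProjDim C ≤ n ↔ ∀ X : C, HasProjectiveDimensionLT X (n + 1) := by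
  simp only [catProjDim, iSup_le_iff, projDim_le_iff_hasProjectiveDimensionLT]

end ProjectiveDimension

/-! ### The edge-vertex presentation in dimension at most one. -/

section Edges

variable {Q : Type u} [PartialOrder Q] {C : Type w} [Category.{v} C] [Abelian C]
  (S : Set Q)

/-- The covering pairs of elements of `S`. -/
abbrev Edge : Type u := {e : S × S // e.1 ⋖ e.2}

namespace Edge

variable {S}

/-- The lower element of a covering pair. -/
abbrev src (e : Edge S) : S := e.1.1

/-- The upper element of a covering pair. -/
abbrev tgt (e : Edge S) : S := e.1.2

lemma le (e : Edge S) : (e.src : Q) ≤ e.tgt := e.2.le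

end Edge

variable {S}

/-- The interval from `e.src` to `q` is a chain. If the conclusion failed, covering would force the
two pairs to have equal sources and then equal targets. -/
lemma DimLEOne.tgt_le_src (hQ : DimLEOne Q) {e e' : Edge S} (hne : e' ≠ e) {q : Q}
    (he : (e.tgt : Q) ≤ q) (hs : e.src ≤ e'.src) (he' : (e'.tgt : Q) ≤ q) : e.tgt ≤ e'.src := by
  obtain h | h := hQ e.src e.tgt e'.src q e.le he hs (e'.le.trans he')
  · exact h
  · by_contra hcon
    have hsrc : e.src = e'.src :=
      hs.eq_of_not_lt fun h' => e.2.2 h' (lt_of_le_not_ge h hcon)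
    refine hne (Subtype.ext (Prod.ext hsrc.symm ?_))
    have h1 : e.src < e'.tgt := hs.trans_lt e'.2.lt
    have h2 : e'.src < e.tgt := hsrc ▸ e.2.lt
    obtain h3 | h3 := hQ e.src e.tgt e'.tgt q e.le he h1.le he'
    · exact (LE.le.eq_of_not_lt (show e.tgt ≤ e'.tgt from h3) fun h' => e'.2.2 h2 h').symm
    · exact LE.le.eq_of_not_lt (show e'.tgt ≤ e.tgt from h3) fun h' => e.2.2 h1 h'

variable [Finite S] (X : Q ⥤ C)

variable (S) in
/-- The free functor on the values of `X` at the elements of `S`. -/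
noncomputable abbrev vertexFree : Q ⥤ C := free (Subtype.val : S → Q) fun s => X.obj s

variable (S) in
/-- The free functor on the values of `X` at the lower elements of covering pairs in `S`, placed at
the upper elements. -/
noncomputable abbrev edgeFree : Q ⥤ C :=
  free (fun e : Edge S => (e.tgt : Q)) fun e => X.obj e.src

variable (S) in
/-- The canonical morphism to `X` from the free functor on its values. -/
noncomputable def vertexFreeDesc : vertexFree S X ⟶ X :=
  free.desc fun s => 𝟙 (X.obj s)

variable (S) in
/-- The relations between the generators of `vertexFree S X`. -/
noncomputable def edgeToVertex : edgeFree S X ⟶ vertexFree S X :=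
  free.desc fun e => X.map (homOfLE e.le) ≫
      free.incl Subtype.val (fun s : S => X.obj s) e.tgt le_rfl -
    free.incl Subtype.val (fun s : S => X.obj s) e.src e.le

/-- The inclusion of the value of `X` at an element of `S`. -/
noncomputable abbrev vertexIncl (s : S) {q : Q} (h : (s : Q) ≤ q) :
    X.obj s ⟶ (vertexFree S X).obj q :=
  free.incl Subtype.val (fun s : S => X.obj s) s h

/-- The inclusion of the value of `X` at the lower element of a covering pair. -/
noncomputable abbrev edgeIncl (e : Edge S) {q : Q} (h : (e.tgt : Q) ≤ q) :
    X.obj e.src ⟶ (edgeFree S X).obj q :=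
  free.incl (fun e : Edge S => (e.tgt : Q)) (fun e : Edge S => X.obj e.src) e h

lemma vertexIncl_desc (s : S) {q : Q} (h : (s : Q) ≤ q) :
    vertexIncl X s h ≫ (vertexFreeDesc S X).app q = X.map (homOfLE h) :=
  (free.incl_desc_app (fun s : S => 𝟙 (X.obj s)) s h).trans (Category.id_comp _)

lemma edgeIncl_edgeToVertex (e : Edge S) {q : Q} (h : (e.tgt : Q) ≤ q) :
    edgeIncl X e h ≫ (edgeToVertex S X).app q =
      X.map (homOfLE e.le) ≫ vertexIncl X e.tgt h - vertexIncl X e.src (e.le.trans h) := by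
  refine (free.incl_desc_app _ e h).trans ?_
  rw [Preadditive.sub_comp, Category.assoc, free.incl_map, free.incl_map]

lemma edgeToVertex_desc : edgeToVertex S X ≫ vertexFreeDesc S X = 0 := by
  ext q
  refine free.obj_hom_ext fun e h => ?_
  rw [NatTrans.comp_app, ← Category.assoc, edgeIncl_edgeToVertex, Preadditive.sub_comp,
    Category.assoc, vertexIncl_desc, vertexIncl_desc, ← X.map_comp]
  exact (sub_self _).trans comp_zero.symm

open Classical in
/-- The contribution of the covering pair `e` to the chain of covering pairs from `s` to the
greatest element of `S` below `q`. -/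
noncomputable def chainTerm (s : S) (q : Q) (e : Edge S) : X.obj s ⟶ (edgeFree S X).obj q :=
  if h : s ≤ e.src ∧ (e.tgt : Q) ≤ q then X.map (homOfLE h.1) ≫ edgeIncl X e h.2 else 0

/-- The sum over the chain of covering pairs from `s` to the greatest element of `S` below `q`. -/
noncomputable def chainSum (s : S) (q : Q) : X.obj s ⟶ (edgeFree S X).obj q :=
  letI := Fintype.ofFinite (Edge S)
  ∑ e : Edge S, chainTerm X s q e

lemma chainTerm_self (e : Edge S) {q : Q} (h : (e.tgt : Q) ≤ q) :
    chainTerm X e.src q e = edgeIncl X e h := by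
  rw [chainTerm, dif_pos ⟨le_rfl, h⟩]
  exact (congrArg (· ≫ edgeIncl X e h) (X.map_id _)).trans (Category.id_comp _)

lemma chainTerm_tgt_self (e : Edge S) (q : Q) : chainTerm X e.tgt q e = 0 :=
  dif_neg fun h => e.2.lt.not_ge h.1

lemma chainTerm_of_ne (hQ : DimLEOne Q) {e e' : Edge S} (hne : e' ≠ e) {q : Q}
    (h : (e.tgt : Q) ≤ q) :
    chainTerm X e.src q e' = X.map (homOfLE e.le) ≫ chainTerm X e.tgt q e' := by
  by_cases h' : e.src ≤ e'.src ∧ (e'.tgt : Q) ≤ q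
  · have h'' : e.tgt ≤ e'.src := hQ.tgt_le_src hne h h'.1 h'.2
    rw [chainTerm, chainTerm, dif_pos h', dif_pos ⟨h'', h'.2⟩, ← Category.assoc, ← X.map_comp]
    rfl
  · rw [chainTerm, chainTerm, dif_neg h', dif_neg fun h'' => h' ⟨e.2.le.trans h''.1, h''.2⟩,
      comp_zero]

/-- Passing from `e.src` to `e.tgt` removes exactly the term of `e`; all other terms factor through
the structure map by `chainTerm_of_ne`. -/
lemma chainSum_src (hQ : DimLEOne Q) (e : Edge S) {q : Q} (h : (e.tgt : Q) ≤ q) :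
    chainSum X e.src q = edgeIncl X e h + X.map (homOfLE e.le) ≫ chainSum X e.tgt q := by
  classical
  let _ := Fintype.ofFinite (Edge S)
  change ∑ e', chainTerm X e.src q e' = _ + _ ≫ ∑ e', chainTerm X e.tgt q e'
  rw [← Finset.add_sum_erase _ _ (Finset.mem_univ e),
    ← Finset.add_sum_erase _ (chainTerm X e.tgt q) (Finset.mem_univ e), chainTerm_self X e h,
    chainTerm_tgt_self, zero_add, Preadditive.comp_sum]
  congr 1
  exact Finset.sum_congr rfl fun e' he' => chainTerm_of_ne X hQ (Finset.ne_of_mem_erase he') h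

lemma chainSum_of_isGreatest {x : S} {q : Q} (hx : IsGreatest (S ∩ Set.Iic q) x) :
    chainSum X x q = 0 :=
  Finset.sum_eq_zero fun e _ => dif_neg fun h =>
    (e.2.lt.trans_le (hx.2 ⟨e.tgt.2, h.2⟩)).not_ge h.1

/-- The relations along the chain from `s` to the floor `x` telescope; the induction descends from
`x`. -/
lemma chainSum_edgeToVertex (hQ : DimLEOne Q) {x : S} {q : Q} (hx : IsGreatest (S ∩ Set.Iic q) x)
    (s : S) (hs : (s : Q) ≤ x) (hq : (x : Q) ≤ q) :
    chainSum X s q ≫ (edgeToVertex S X).app q =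
      X.map (homOfLE hs) ≫ vertexIncl X x hq - vertexIncl X s (hs.trans hq) := by
  induction s using WellFoundedGT.induction with
  | ind s ih =>
    obtain rfl | hlt := eq_or_lt_of_le (show s ≤ x from hs)
    · rw [chainSum_of_isGreatest X hx, zero_comp]
      refine (sub_eq_zero.2 ?_).symm
      exact (congrArg (· ≫ vertexIncl X s hq) (X.map_id _)).trans (Category.id_comp _)
    · obtain ⟨t, hst, htx⟩ := exists_covBy_le_of_lt hlt
      let e : Edge S := ⟨(s, t), hst⟩
      have h1 := chainSum_src X hQ e (show (e.tgt : Q) ≤ q from le_trans htx hq)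
      have h2 := ih t hst.lt htx
      have h3 : X.map (homOfLE hs) = X.map (homOfLE e.le) ≫ X.map (homOfLE htx) := by
        rw [← X.map_comp]
        rfl
      change chainSum X e.src q ≫ _ = _
      rw [h1, Preadditive.add_comp, edgeIncl_edgeToVertex, Category.assoc]
      change _ + X.map (homOfLE e.le) ≫ chainSum X t q ≫ _ = _
      rw [h2, h3, Preadditive.comp_sub, Category.assoc]
      abel

/-- The retraction of `edgeToVertex S X` at `q`, for a poset of dimension at most one. -/
noncomputable def vertexToEdge (q : Q) : (vertexFree S X).obj q ⟶ (edgeFree S X).obj q :=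
  free.objDesc fun s _ => - chainSum X s q

lemma vertexIncl_vertexToEdge (s : S) {q : Q} (h : (s : Q) ≤ q) :
    vertexIncl X s h ≫ vertexToEdge X q = - chainSum X s q :=
  free.incl_objDesc (fun s _ => - chainSum X s q) s h

lemma edgeToVertex_vertexToEdge (hQ : DimLEOne Q) (q : Q) :
    (edgeToVertex S X).app q ≫ vertexToEdge X q = 𝟙 _ := by
  refine free.obj_hom_ext fun e h => ?_
  have h1 := edgeIncl_edgeToVertex X e h
  rw [← Category.assoc, h1, Preadditive.sub_comp, Category.assoc, vertexIncl_vertexToEdge,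
    vertexIncl_vertexToEdge, chainSum_src X hQ e h, Category.comp_id, Preadditive.comp_neg]
  abel

lemma vertexToEdge_edgeToVertex (hQ : DimLEOne Q) {x : S} {q : Q}
    (hx : IsGreatest (S ∩ Set.Iic q) x) (hq : (x : Q) ≤ q) [IsIso (X.map (homOfLE hq))] :
    vertexToEdge X q ≫ (edgeToVertex S X).app q + (vertexFreeDesc S X).app q ≫
      inv (X.map (homOfLE hq)) ≫ vertexIncl X x hq = 𝟙 _ := by
  refine free.obj_hom_ext fun s h => ?_
  have hs : (s : Q) ≤ x := hx.2 ⟨s.2, h⟩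
  have h1 := vertexIncl_vertexToEdge X s h
  have h2 := vertexIncl_desc X s h
  have h3 : X.map (homOfLE h) = X.map (homOfLE hs) ≫ X.map (homOfLE hq) := by
    rw [← X.map_comp]
    rfl
  rw [Preadditive.comp_add, ← Category.assoc, h1, Preadditive.neg_comp,
    chainSum_edgeToVertex X hQ hx s hs hq, ← Category.assoc, h2, h3,
    Category.assoc, IsIso.hom_inv_id_assoc, Category.comp_id]
  abel

/-- At each `q` the sequence splits: the section goes through the floor and the retraction is minus
the chain sum. Naturality of the splittings in `q` is not needed. Without a floor all three terms
vanish. -/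
lemma edgeVertex_shortExact (hQ : DimLEOne Q) (hS : HasFloors S) {X : Q ⥤ C}
    (hX : IsConstructible S X) (q : Q) :
    (ShortComplex.mk ((edgeToVertex S X).app q) ((vertexFreeDesc S X).app q)
      (congr_app (edgeToVertex_desc X) q)).ShortExact := by
  by_cases hq : ∃ s ∈ S, s ≤ q
  · obtain ⟨s, hs, hsq⟩ := hq
    obtain ⟨x, hx⟩ := hS q s hs hsq
    have hq : x ≤ q := hx.1.2
    have := hX.isIso x q hq hx
    exact ShortComplex.Splitting.shortExact
      { r := vertexToEdge X q
        s := inv (X.map (homOfLE hq)) ≫ vertexIncl X ⟨x, hx.1.1⟩ hq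
        f_r := edgeToVertex_vertexToEdge X hQ q
        s_g := by
          have := vertexIncl_desc X ⟨x, hx.1.1⟩ hq
          rw [Category.assoc, this, IsIso.inv_hom_id]
        id := vertexToEdge_edgeToVertex X hQ (x := ⟨x, hx.1.1⟩) hx hq }
  · push Not at hq
    have h₁ : IsZero ((edgeFree S X).obj q) := (IsZero.iff_id_eq_zero _).2
      (free.obj_hom_ext fun e h => absurd h (hq _ e.tgt.2))
    have h₂ : IsZero ((vertexFree S X).obj q) := (IsZero.iff_id_eq_zero _).2
      (free.obj_hom_ext fun s h => absurd h (hq _ s.2))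
    exact ShortComplex.Splitting.shortExact
      { r := 0, s := 0
        f_r := h₁.eq_of_src _ _
        s_g := (hX.isZero q hq).eq_of_src _ _
        id := h₂.eq_of_src _ _ }

end Edges

/-! ### Exactness for tame functors and the dimension bound. -/

section Exactness

variable {Q : Type u} [PartialOrder Q] {C : Type w} [Category.{v} C] [Abelian C]

lemma free.map_comp_map {I : Type*} [Finite I] {t : I → Q} {K P A : I → C} (a : ∀ i, K i ⟶ P i)
    (b : ∀ i, P i ⟶ A i) (w : ∀ i, a i ≫ b i = 0) :
    (free.map a : free t K ⟶ _) ≫ free.map b = 0 := by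
  ext q
  refine free.obj_hom_ext fun i h => ?_
  rw [NatTrans.comp_app, ← Category.assoc, free.incl_map_app, Category.assoc, free.incl_map_app,
    ← Category.assoc, w, zero_comp]
  exact comp_zero.symm

lemma free.shortExact {I : Type*} [Finite I] (t : I → Q) {K P A : I → C} (a : ∀ i, K i ⟶ P i)
    (b : ∀ i, P i ⟶ A i) (w : ∀ i, a i ≫ b i = 0)
    (h : ∀ i, (ShortComplex.mk (a i) (b i) (w i)).ShortExact) (q : Q) :
    (ShortComplex.mk ((free.map a : free t K ⟶ _).app q) ((free.map b).app q)
      (congr_app (free.map_comp_map a b w) q)).ShortExact := by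
  have : ∀ i, Mono (a i) := fun i => (h i).mono_f
  have hb : ∀ i, Epi (b i) := fun i => (h i).epi_g
  refine { exact := ?_, mono_f := inferInstance, epi_g := inferInstance }
  refine ShortComplex.exact_of_g_is_cokernel _ (CokernelCofork.IsColimit.ofπ _ _
    (fun {Z} k hk => free.objDesc fun i hi =>
      have : Epi (ShortComplex.mk (a i) (b i) (w i)).g := hb i
      (h i).exact.desc (free.incl t P i hi ≫ k) ?_)
    (fun {Z} k hk => ?_) (fun {Z} k hk m hm => ?_))
  · dsimp only
    rw [← Category.assoc, ← free.incl_map_app, Category.assoc, hk, comp_zero]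
  · refine free.obj_hom_ext fun i hi => ?_
    dsimp only
    rw [← Category.assoc, free.incl_map_app, Category.assoc, free.incl_objDesc]
    have : Epi (ShortComplex.mk (a i) (b i) (w i)).g := hb i
    exact (h i).exact.g_desc _ _
  · rw [← cancel_epi ((free.map b : free t P ⟶ _).app q), hm]
    refine free.obj_hom_ext fun i hi => ?_
    rw [← Category.assoc, free.incl_map_app, Category.assoc, free.incl_objDesc]
    have : Epi (ShortComplex.mk (a i) (b i) (w i)).g := hb i
    exact ((h i).exact.g_desc _ _).symm

lemma functor_shortExact {X Y Z : Q ⥤ C} (f : X ⟶ Y) (g : Y ⟶ Z) (w : f ≫ g = 0)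
    (h : ∀ q, (ShortComplex.mk (f.app q) (g.app q) (congr_app w q)).ShortExact) :
    (ShortComplex.mk f g w).ShortExact := by
  have hm : ∀ q, Mono (f.app q) := fun q => (h q).mono_f
  have he : ∀ q, Epi (g.app q) := fun q => (h q).epi_g
  refine { exact := ?_, mono_f := NatTrans.mono_of_mono_app f, epi_g := NatTrans.epi_of_epi_app g }
  rw [ShortComplex.exact_iff_isZero_homology]
  refine Functor.isZero _ fun q => ?_
  refine IsZero.of_iso ?_
    ((ShortComplex.mk f g w).mapHomologyIso ((evaluation Q C).obj q)).symm
  exact (ShortComplex.exact_iff_isZero_homology _).1 (h q).exact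

variable [(isTame Q C).ContainsZero] [(isTame Q C).IsClosedUnderKernels]
  [(isTame Q C).IsClosedUnderCokernels] [(isTame Q C).IsClosedUnderFiniteProducts]

/-- The inclusion into `Q ⥤ C` is faithful and preserves kernels and cokernels, so it reflects
exactness. -/
lemma tame_shortExact {X Y Z : Tame Q C} (f : X ⟶ Y) (g : Y ⟶ Z) (w : f.hom ≫ g.hom = 0)
    (h : ∀ q, (ShortComplex.mk (f.hom.app q) (g.hom.app q) (congr_app w q)).ShortExact) :
    (ShortComplex.mk f g (by ext1; exact w)).ShortExact := by
  have hfun := functor_shortExact f.hom g.hom w h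
  have : (isTame Q C).ι.PreservesHomology :=
    { preservesKernels := fun _ _ f => (isTame Q C).preservesKernels_ι f
      preservesCokernels := fun _ _ f => (isTame Q C).preservesCokernels_ι f }
  refine
    { exact := (ShortComplex.exact_map_iff_of_faithful _ (isTame Q C).ι).1 hfun.exact
      mono_f := (isTame Q C).ι.mono_of_mono_map hfun.mono_f
      epi_g := (isTame Q C).ι.epi_of_epi_map hfun.epi_g }

/-- Induction on syzygies: free functors turn the projective presentations of the `A i` into one of
`tameFree t A`. -/
lemma tameFree.hasProjectiveDimensionLT [EnoughProjectives C] {I : Type u} [Finite I] (t : I → Q)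
    (n : ℕ) (A : I → C) (hA : ∀ i, HasProjectiveDimensionLT (A i) (n + 1)) :
    HasProjectiveDimensionLT (tameFree t A) (n + 1) := by
  induction n generalizing A with
  | zero =>
    have : ∀ i, Projective (A i) := fun i => projective_iff_hasProjectiveDimensionLT_one.2 (hA i)
    exact projective_iff_hasProjectiveDimensionLT_one.1 (tameFree.projective t A)
  | succ n ih =>
    have hS : ∀ i, (ShortComplex.mk (kernel.ι (Projective.π (A i))) (Projective.π (A i))
        (kernel.condition _)).ShortExact := fun i =>
      { exact := ShortComplex.exact_of_f_is_kernel _ (kernelIsKernel _)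
        mono_f := inferInstanceAs (Mono (kernel.ι _))
        epi_g := inferInstanceAs (Epi (Projective.π (A i))) }
    have h1 := ih (fun i => kernel (Projective.π (A i))) fun i =>
      ((hS i).hasProjectiveDimensionLT_X₃_iff n (Projective.projective_over _)).1 (hA i)
    have hex := tame_shortExact (X := tameFree t _) (Y := tameFree t _) (Z := tameFree t A)
      ((isTame Q C).homMk (free.map fun i => kernel.ι (Projective.π (A i))))
      ((isTame Q C).homMk (free.map fun i => Projective.π (A i)))
      (free.map_comp_map _ _ fun i => kernel.condition _) (free.shortExact t _ _ _ hS)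
    exact (hex.hasProjectiveDimensionLT_X₃_iff n (tameFree.projective t _)).2 h1

lemma catProjDim_tame_le (hT : TameDiscretizableByTransfers Q C) [EnoughProjectives C]
    (hQ : DimLEOne Q) : catProjDim (Tame Q C) ≤ catProjDim C + 1 := by
  have := enoughProjectives_tame hT
  -- Only a finite bound carries content; it is then a natural number `n`.
  obtain h | h := eq_or_ne (catProjDim C) ⊤
  · simp [h]
  obtain ⟨n, hn⟩ := ENat.ne_top_iff_exists.1 h
  have hC := (catProjDim_le_iff n).1 hn.ge
  rw [← hn]
  refine (catProjDim_le_iff (n + 1)).2 fun X => ?_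
  obtain ⟨S, h₁, h₂, h₃⟩ := exists_isConstructible hT X.property
  have := h₁.to_subtype
  have hex := tame_shortExact
    (X := tameFree (fun e : Edge S => (e.tgt : Q)) fun e => X.obj.obj e.src)
    (Y := tameFree (Subtype.val : S → Q) fun s => X.obj.obj s) (Z := X)
    ((isTame Q C).homMk (edgeToVertex S X.obj)) ((isTame Q C).homMk (vertexFreeDesc S X.obj))
    (edgeToVertex_desc X.obj) (edgeVertex_shortExact hQ h₂ h₃)
  -- Dimension at most `n` on the edge term gives at most `n + 1` on `X`; the vertex bound is merely
  -- weakened.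
  refine hex.hasProjectiveDimensionLT_X₃ (n + 1)
    (tameFree.hasProjectiveDimensionLT _ n _ fun _ => hC _) ?_
  have := tameFree.hasProjectiveDimensionLT (Subtype.val : S → Q) n (fun s => X.obj.obj s)
    fun _ => hC _
  exact hasProjectiveDimensionLT_of_ge _ (n + 1) _ (by omega)

end Exactness

end TameFunctors

open TameFunctors in
theorem mainTheorem3 {Q : Type u} [PartialOrder Q] {C : Type w} [Category.{v} C] [Abelian C]
    (hQ : TameFunctors.TameDiscretizableByTransfers Q C) :
    ∃ _ : Abelian (TameFunctors.Tame Q C),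
      (EnoughProjectives C → EnoughProjectives (TameFunctors.Tame Q C)) ∧
      (TameFunctors.MinimalCoverAxiom C →
        TameFunctors.MinimalCoverAxiom (TameFunctors.Tame Q C)) ∧
      (EnoughProjectives C → TameFunctors.DimLEOne Q →
        TameFunctors.catProjDim (TameFunctors.Tame Q C) ≤ TameFunctors.catProjDim C + 1) := by
  have := containsZero_isTame Q C
  have := isClosedUnderKernels_isTame hQ
  have := isClosedUnderCokernels_isTame hQ
  have := isClosedUnderFiniteProducts_isTame hQ
  exact ⟨inferInstance, fun _ => enoughProjectives_tame hQ, minimalCoverAxiom_tame hQ,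
    fun _ hdim => catProjDim_tame_le hQ hdim⟩
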